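/- **Catoids.** A *catoid* $(C,\odot,s,t)$ is a set $C$ with a multioperation $\odot:C\times C\to\mathcal P(C)$ and maps $s,t:C\to C$ such that, for all $x,y,z\in C$, $\bigcup_{v\in y\odot z}x\odot v=\bigcup_{u\in x\odot y}u\odot z$; $x\odot y\neq\emptyset$ implies $t(x)=s(y)$; $s(x)\odot x=\{x\}$; and $x\odot t(x)=\{x\}$. For $X,Y\subseteq C$ put $X\odot Y=\bigcup_{x\in X,y\in Y}x\odot y$. The elements of $C_0=\{x\mid s(x)=x\}$ (equivalently $t(x)=x$) are the *identities*. The catoid is *local* if $t(x)=s(y)$ implies $x\odot y\ne\emptyset$. A *decomposition* of $x$ is a finite list $(x_1,\dots,x_m)$, $m\ge 0$, of non-identity elements with $x\in x_1\odot\dots\odot x_m$ (the empty composition being $C_0$); $C$ is *Möbius* if every element has only finitely many decompositions. $C$ has *finite valency* if $\{x\mid s(x)=e\}$ and $\{x\mid t(x)=e\}$ are finite for every $e\in C_0$. An *$n$-catoid* $(C,\odot_i,s_i,t_i)_{0\le i<n}$ consists of catoids $(C,\odot_i,s_i,t_i)$ on the same set such that for all $i\neq j$: $s_is_j=s_js_i$,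 $s_it_j=t_js_i$, $t_is_j=s_jt_i$, $t_it_j=t_jt_i$, $s_i(x\odot_j y)\subseteq s_i(x)\odot_j s_i(y)$, $t_i(x\odot_j y)\subseteq t_i(x)\odot_j t_i(y)$; and for all $i<j$: $(w\odot_j x)\odot_i(y\odot_j z)\subseteq(w\odot_i y)\odot_j(x\odot_i z)$, $s_js_i=s_i$, $s_jt_i=t_i$, $t_js_i=s_i$, $t_jt_i=t_i$, $s_j(s_j(x)\odot_i s_j(y))=s_j(x)\odot_i s_j(y)$, $t_j(t_j(x)\odot_i t_j(y))=t_j(x)\odot_i t_j(y)$. It is local, Möbius, or of finite valency if each $(C,\odot_i,s_i,t_i)$ is. **$n$-Kleene algebras.** A *dioid* is a semiring with idempotent addition, ordered by $\alpha\le\beta\iff\alpha+\beta=\beta$. A *modal semiring* is a dioid with maps $d^-,d^+$ such that $\alpha\le d^-(\alpha)\cdot\alpha$, $d^-(\alpha\cdot d^-(\beta))=d^-(\alpha\cdot\beta)$, $d^-(\alpha)\le1$, $d^-(0)=0$, $d^-(\alpha+\beta)=d^-(\alpha)+d^-(\beta)$; $\alpha\le\alpha\cdot d^+(\alpha)$,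 $d^+(d^+(\alpha)\cdot\beta)=d^+(\alpha\cdot\beta)$, $d^+(\alpha)\le1$, $d^+(0)=0$, $d^+(\alpha+\beta)=d^+(\alpha)+d^+(\beta)$; $d^+(d^-(\alpha))=d^-(\alpha)$ and $d^-(d^+(\alpha))=d^+(\alpha)$. A *Kleene algebra* is a dioid with a map $(-)^*$ such that $1+\alpha\cdot\alpha^*\le\alpha^*$, $\gamma+\alpha\cdot\beta\le\beta\Rightarrow\alpha^*\cdot\gamma\le\beta$ and $\gamma+\beta\cdot\alpha\le\beta\Rightarrow\gamma\cdot\alpha^*\le\beta$. An *$n$-Kleene algebra* $(K,+,0,\cdot_i,1_i,d^-_i,d^+_i,(-)^{*_i})_{0\le i<n}$ is such that each $(K,+,0,\cdot_i,1_i,d_i^-,d_i^+)$ is a modal semiring and each $(K,+,0,\cdot_i,1_i,(-)^{*_i})$ is a Kleene algebra; for all $i\ne j$, $d^-_i(\alpha\cdot_j\beta)\le d^-_i(\alpha)\cdot_j d^-_i(\beta)$ and $d^+_i(\alpha\cdot_j\beta)\le d^+_i(\alpha)\cdot_j d^+_i(\beta)$; and for all $i<j$, $$(\alpha\cdot_j\beta)\cdot_i(\gamma\cdot_j\delta)\le(\alpha\cdot_i\gamma)\cdot_j(\beta\cdot_i\delta),\qquad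 d^-_j(d^-_i(\alpha))=d^-_i(\alpha),$$ $$d^-_j(d^-_j(\alpha)\cdot_i d^-_j(\beta))=d^-_j(\alpha)\cdot_i d^-_j(\beta),\qquad d^+_j(d^+_j(\alpha)\cdot_i d^+_j(\beta))=d^+_j(\alpha)\cdot_i d^+_j(\beta),$$ $$d^-_i(\alpha)\cdot_i\beta^{*_j}\le(d^-_i(\alpha)\cdot_i\beta)^{*_j},\qquad \alpha^{*_j}\cdot_i d^+_i(\beta)\le(\alpha\cdot_i d^+_i(\beta))^{*_j}.$$ **Convolution.** Let $C$ be a Möbius $n$-catoid of finite valency and $K$ an $n$-Kleene algebra. Write $C_{0,i}$ for the set of identities of $(C,\odot_i,s_i,t_i)$. On the set $K^C$ of functions $C\to K$ let $+$ and $0$ be pointwise and define, for each $0\le i<n$ (all sums below have finitely many nonzero summands), $$(f*_i g)(x)=\sum_{y,z\,:\,x\in y\odot_i z}f(y)\cdot_i g(z),\qquad \mathrm{id}_i(x)=\begin{cases}1_i&x\in C_{0,i},\\0&\text{otherwise,}\end{cases}$$ $$D^-_i(f)(x)=\sum_{y\,:\,s_i(y)=x}d^-_i(f(y)),\qquad D^+_i(f)(x)=\sum_{y\,:\,t_i(y)=x}d^+_i(f(y)),$$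 and, by recursion on the maximal length of a decomposition of $x$ in $(C,\odot_i,s_i,t_i)$, $$f^{*_i}(x)=f(x)^{*_i}\ \text{ if }x\in C_{0,i},\qquad f^{*_i}(x)=f(s_i(x))^{*_i}\cdot_i\sum_{\substack{y,z\,:\,x\in y\odot_i z\\ y\ne s_i(x)}}f(y)\cdot_i f^{*_i}(z)\ \text{ otherwise.}$$ **Theorem.** If $C$ is a local Möbius $n$-catoid of finite valency and $K$ is an $n$-Kleene algebra, then $(K^C,+,0,*_i,\mathrm{id}_i,D^-_i,D^+_i,(-)^{*_i})_{0\le i<n}$ is an $n$-Kleene algebra. In particular, for all $f,g:C\to K$ and $0\le i<j<n$, $$D^-_i(f)*_i g^{*_j}\le(D^-_i(f)*_i g)^{*_j},\qquad f^{*_j}*_i D^+_i(g)\le(f*_i D^+_i(g))^{*_j}.$$ -/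

import Mathlib

open scoped BigOperators

universe u v

/-! ## Catoids -/

/-- A catoid: a set with a multi-valued composition and source and target maps. -/
structure Catoid (C : Type u) where
  comp : C → C → Set C
  src : C → C
  tgt : C → C
  assoc : ∀ x y z : C, (⋃ v ∈ comp y z, comp x v) = ⋃ w ∈ comp x y, comp w z
  tgt_eq_src : ∀ x y : C, (comp x y).Nonempty → tgt x = src y
  src_comp : ∀ x : C, comp (src x) x = {x}
  comp_tgt : ∀ x : C, comp x (tgt x) = {x}

namespace Catoid

/-- The extension of the composition to sets. -/
def compSet {C : Type u} (c : Catoid C) (X Y : Set C) : Set C :=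
  ⋃ x ∈ X, ⋃ y ∈ Y, c.comp x y

/-- Composable whenever target and source match. -/
def IsLocal {C : Type u} (c : Catoid C) : Prop :=
  ∀ x y : C, c.tgt x = c.src y → (c.comp x y).Nonempty

/-- Identities are the fixpoints of the source map (equivalently, of the target map). -/
def IsIdentity {C : Type u} (c : Catoid C) (x : C) : Prop := c.src x = x

/-- The set `x₁ ⊙ ⋯ ⊙ xₙ`; the empty composition is the set of all identities. -/
def prod {C : Type u} (c : Catoid C) : List C → Set C
  | [] => {e | c.IsIdentity e}
  | x :: l => c.compSet {x} (c.prod l)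

/-- The decompositions of `x`: lists of non-identities whose composition contains `x`.
The degree of a decomposition is the length of the list. -/
def decompositions {C : Type u} (c : Catoid C) (x : C) : Set (List C) :=
  {l | (∀ y ∈ l, ¬ c.IsIdentity y) ∧ x ∈ c.prod l}

/-- The length of an element: the supremum of the degrees of its decompositions. -/
noncomputable def length {C : Type u} (c : Catoid C) (x : C) : ℕ∞ :=
  ⨆ l ∈ c.decompositions x, (l.length : ℕ∞)

/-- A catoid is Möbius if each element has only finitely many decompositions. -/
def IsMobius {C : Type u} (c : Catoid C) : Prop :=
  ∀ x : C, (c.decompositions x).Finite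

/-- Only finitely many elements start, and only finitely many end, in a given identity. -/
def FiniteValency {C : Type u} (c : Catoid C) : Prop :=
  ∀ e : C, c.IsIdentity e → {x | c.src x = e}.Finite ∧ {x | c.tgt x = e}.Finite

theorem src_tgt {C : Type u} (c : Catoid C) (x : C) : c.src (c.tgt x) = c.tgt x :=
  (c.tgt_eq_src x (c.tgt x) (by rw [c.comp_tgt]; exact Set.singleton_nonempty x)).symm

theorem tgt_src {C : Type u} (c : Catoid C) (x : C) : c.tgt (c.src x) = c.src x :=
  c.tgt_eq_src (c.src x) x (by rw [c.src_comp]; exact Set.singleton_nonempty x)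

theorem src_src {C : Type u} (c : Catoid C) (x : C) : c.src (c.src x) = c.src x := by
  have h := c.src_tgt (c.src x)
  rwa [c.tgt_src] at h

theorem cons_mem_decompositions {C : Type u} (c : Catoid C) {x y z : C} {l : List C}
    (hy : ¬ c.IsIdentity y) (hx : x ∈ c.comp y z) (hl : l ∈ c.decompositions z) :
    y :: l ∈ c.decompositions x := by
  refine ⟨?_, ?_⟩
  · intro w hw
    rcases List.mem_cons.1 hw with rfl | hw
    · exact hy
    · exact hl.1 w hw
  · simp only [prod, compSet, Set.mem_iUnion, Set.mem_singleton_iff]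
    exact ⟨y, rfl, z, hl.2, hx⟩

theorem singleton_mem_decompositions {C : Type u} (c : Catoid C) {x : C}
    (hx : ¬ c.IsIdentity x) : [x] ∈ c.decompositions x := by
  refine c.cons_mem_decompositions (z := c.tgt x) hx ?_ ⟨by simp, c.src_tgt x⟩
  rw [c.comp_tgt]
  exact Set.mem_singleton x

theorem decompositions_nonempty {C : Type u} (c : Catoid C) (x : C) :
    (c.decompositions x).Nonempty := by
  by_cases hx : c.IsIdentity x
  · exact ⟨[], by simp, hx⟩
  · exact ⟨[x], c.singleton_mem_decompositions hx⟩

/-- In a Möbius catoid every element is in the composite of finitely many pairs only. -/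
theorem finite_splits {C : Type u} (c : Catoid C) (h : c.IsMobius) (x : C) :
    {p : C × C | x ∈ c.comp p.1 p.2}.Finite := by
  have h2 : ((fun p : C × C => [p.1, p.2]) ⁻¹' c.decompositions x).Finite := by
    refine (h x).preimage ?_
    rintro ⟨a, b⟩ _ ⟨a', b'⟩ _ hab
    simpa using hab
  refine ((h2.insert (x, c.tgt x)).insert (c.src x, x)).subset ?_
  rintro ⟨y, z⟩ hx
  have hx : x ∈ c.comp y z := hx
  have hyz : c.tgt y = c.src z := c.tgt_eq_src y z ⟨x, hx⟩
  by_cases hy : c.IsIdentity y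
  · left
    have e : y = c.src z := by
      rw [← hyz, ← show c.src y = y from hy, c.tgt_src]
    have hxz : x = z := by
      rw [e, c.src_comp] at hx
      exact hx
    rw [e, hxz]
  · by_cases hz : c.IsIdentity z
    · right; left
      have e : z = c.tgt y := by rw [hyz]; exact hz.symm
      have hxy : x = y := by
        rw [e, c.comp_tgt] at hx
        exact hx
      rw [e, hxy]
    · right; right
      exact c.cons_mem_decompositions hy hx (c.singleton_mem_decompositions hz)

theorem length_lt {C : Type u} (c : Catoid C) (h : c.IsMobius) {x y z : C}
    (hx : x ∈ c.comp y z) (hy : y ≠ c.src x) : c.length z < c.length x := by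
  have hyz : c.tgt y = c.src z := c.tgt_eq_src y z ⟨x, hx⟩
  have hy' : ¬ c.IsIdentity y := by
    intro hi
    have e : y = c.src z := by
      rw [← hyz, ← show c.src y = y from hi, c.tgt_src]
    apply hy
    have hxz : x = z := by
      rw [e, c.src_comp] at hx
      exact hx
    rw [e, hxz]
  obtain ⟨l, hl, hmax⟩ := Set.exists_max_image (c.decompositions z) List.length (h z)
    (c.decompositions_nonempty z)
  have h1 : c.length z ≤ (l.length : ℕ∞) :=
    iSup₂_le fun m hm => by exact_mod_cast hmax m hm
  have h2 : (((y :: l).length : ℕ) : ℕ∞) ≤ c.length x :=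
    le_iSup₂ (f := fun (m : List C) (_ : m ∈ c.decompositions x) => (m.length : ℕ∞))
      (y :: l) (c.cons_mem_decompositions hy' hx hl)
  refine lt_of_le_of_lt h1 (lt_of_lt_of_le ?_ h2)
  exact_mod_cast Nat.lt_succ_self l.length

theorem finite_src_fiber {C : Type u} (c : Catoid C) (h : c.FiniteValency) (x : C) :
    {y | c.src y = x}.Finite := by
  by_cases hx : c.IsIdentity x
  · exact (h x hx).1
  · refine Set.Finite.subset Set.finite_empty ?_
    rintro y rfl
    exact hx (c.src_src y)

theorem finite_tgt_fiber {C : Type u} (c : Catoid C) (h : c.FiniteValency) (x : C) :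
    {y | c.tgt y = x}.Finite := by
  by_cases hx : c.IsIdentity x
  · exact (h x hx).2
  · refine Set.Finite.subset Set.finite_empty ?_
    rintro y rfl
    exact hx (c.src_tgt y)

/-- The finite set of all pairs `(y, z)` with `x ∈ y ⊙ z`. -/
noncomputable def splits {C : Type u} (c : Catoid C) (h : c.IsMobius) (x : C) :
    Finset (C × C) :=
  (c.finite_splits h x).toFinset

theorem mem_splits {C : Type u} (c : Catoid C) (h : c.IsMobius) (x : C) (p : C × C) :
    p ∈ c.splits h x ↔ x ∈ c.comp p.1 p.2 := by
  simp [splits]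

/-! ### Convolution operations on functions `C → K`

Sums over all `y, z` with an indicator `[x ∈ y ⊙ z]` are written as sums over the finite set
of those pairs for which the indicator is not `0`, and likewise for the other sums. -/

/-- Convolution: `(f * g)(x) = ∑ f(y) · g(z) · [x ∈ y ⊙ z]`. -/
noncomputable def convMul {C : Type u} {K : Type v} [AddCommMonoid K] (c : Catoid C)
    (h : c.IsMobius) (mul : K → K → K) (f g : C → K) (x : C) : K :=
  ∑ p ∈ c.splits h x, mul (f p.1) (g p.2)

open Classical in
/-- The unit of convolution: `1` on identities and `0` elsewhere. -/
noncomputable def convOne {C : Type u} {K : Type v} [AddCommMonoid K] (c : Catoid C)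
    (one : K) (x : C) : K :=
  if c.IsIdentity x then one else 0

/-- Domain: `D⁻(f)(x) = ∑ d⁻(f(y))`, summed over all `y` with source `x`. -/
noncomputable def convDom {C : Type u} {K : Type v} [AddCommMonoid K] (c : Catoid C)
    (h : c.FiniteValency) (dom : K → K) (f : C → K) (x : C) : K :=
  ∑ y ∈ (c.finite_src_fiber h x).toFinset, dom (f y)

/-- Codomain: `D⁺(f)(x) = ∑ d⁺(f(y))`, summed over all `y` with target `x`. -/
noncomputable def convCod {C : Type u} {K : Type v} [AddCommMonoid K] (c : Catoid C)
    (h : c.FiniteValency) (cod : K → K) (f : C → K) (x : C) : K :=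
  ∑ y ∈ (c.finite_tgt_fiber h x).toFinset, cod (f y)

open Classical in
/-- The star, by recursion on the length: `f*(e) = f(e)*` on identities `e`, and
`f*(x) = f(s(x))* · ∑ f(y) · f*(z) · [x ∈ y ⊙ z, y ≠ s(x)]` on non-identities `x`. -/
noncomputable def convStar {C : Type u} {K : Type v} [AddCommMonoid K] (c : Catoid C)
    (h : c.IsMobius) (mul : K → K → K) (star : K → K) (f : C → K) (x : C) : K :=
  if c.IsIdentity x then star (f x)
  else
    mul (star (f (c.src x)))
      (∑ p ∈ ((c.splits h x).filter fun p => p.1 ≠ c.src x).attach,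
        mul (f p.1.1) (convStar c h mul star f p.1.2))
termination_by c.length x
decreasing_by
  have hp := Finset.mem_filter.1 p.2
  exact c.length_lt h ((c.mem_splits h x p.1).1 hp.1) hp.2

end Catoid

/-! ## Higher catoids -/

/-- An `n`-catoid. -/
structure NCatoid (n : ℕ) (C : Type u) where
  dim : Fin n → Catoid C
  src_src : ∀ i j, i ≠ j → ∀ x, (dim i).src ((dim j).src x) = (dim j).src ((dim i).src x)
  src_tgt : ∀ i j, i ≠ j → ∀ x, (dim i).src ((dim j).tgt x) = (dim j).tgt ((dim i).src x)
  tgt_src : ∀ i j, i ≠ j → ∀ x, (dim i).tgt ((dim j).src x) = (dim j).src ((dim i).tgt x)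
  tgt_tgt : ∀ i j, i ≠ j → ∀ x, (dim i).tgt ((dim j).tgt x) = (dim j).tgt ((dim i).tgt x)
  src_comp_subset : ∀ i j, i ≠ j → ∀ x y,
    (dim i).src '' (dim j).comp x y ⊆ (dim j).comp ((dim i).src x) ((dim i).src y)
  tgt_comp_subset : ∀ i j, i ≠ j → ∀ x y,
    (dim i).tgt '' (dim j).comp x y ⊆ (dim j).comp ((dim i).tgt x) ((dim i).tgt y)
  interchange : ∀ i j, i < j → ∀ w x y z,
    (dim i).compSet ((dim j).comp w x) ((dim j).comp y z) ⊆
      (dim j).compSet ((dim i).comp w y) ((dim i).comp x z)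
  src_src_of_lt : ∀ i j, i < j → ∀ x, (dim j).src ((dim i).src x) = (dim i).src x
  src_tgt_of_lt : ∀ i j, i < j → ∀ x, (dim j).src ((dim i).tgt x) = (dim i).tgt x
  tgt_src_of_lt : ∀ i j, i < j → ∀ x, (dim j).tgt ((dim i).src x) = (dim i).src x
  tgt_tgt_of_lt : ∀ i j, i < j → ∀ x, (dim j).tgt ((dim i).tgt x) = (dim i).tgt x
  src_closure : ∀ i j, i < j → ∀ x y,
    (dim j).src '' (dim i).comp ((dim j).src x) ((dim j).src y) =
      (dim i).comp ((dim j).src x) ((dim j).src y)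
  tgt_closure : ∀ i j, i < j → ∀ x y,
    (dim j).tgt '' (dim i).comp ((dim j).tgt x) ((dim j).tgt y) =
      (dim i).comp ((dim j).tgt x) ((dim j).tgt y)

namespace NCatoid

def IsLocal {n : ℕ} {C : Type u} (X : NCatoid n C) : Prop := ∀ i, (X.dim i).IsLocal

def IsMobius {n : ℕ} {C : Type u} (X : NCatoid n C) : Prop := ∀ i, (X.dim i).IsMobius

def FiniteValency {n : ℕ} {C : Type u} (X : NCatoid n C) : Prop :=
  ∀ i, (X.dim i).FiniteValency

end NCatoid

/-! ## Dioids, modal semirings and Kleene algebras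

Several multiplications live on one additive monoid `S`, so the axioms are stated as
predicates on unbundled operations. -/

/-- The order of a dioid: `a ≤ b` means `a + b = b`. -/
def DioidLE {S : Type v} [AddCommMonoid S] (a b : S) : Prop := a + b = b

infix:50 " ≼ " => DioidLE

/-- `(S, +, 0, ·, 1)` is an additively idempotent semiring. -/
structure IsDioid {S : Type v} [AddCommMonoid S] (mul : S → S → S) (one : S) : Prop where
  add_idem : ∀ a : S, a + a = a
  mul_assoc : ∀ a b c, mul (mul a b) c = mul a (mul b c)
  one_mul : ∀ a, mul one a = a
  mul_one : ∀ a, mul a one = a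
  left_distrib : ∀ a b c, mul a (b + c) = mul a b + mul a c
  right_distrib : ∀ a b c, mul (a + b) c = mul a c + mul b c
  zero_mul : ∀ a, mul 0 a = 0
  mul_zero : ∀ a, mul a 0 = 0

/-- A dioid with domain and codomain operations. -/
structure IsModalSemiring {S : Type v} [AddCommMonoid S] (mul : S → S → S) (one : S)
    (dom cod : S → S) : Prop extends IsDioid mul one where
  le_dom_mul : ∀ a, a ≼ mul (dom a) a
  dom_mul_dom : ∀ a b, dom (mul a (dom b)) = dom (mul a b)
  dom_le_one : ∀ a, dom a ≼ one
  dom_zero : dom 0 = 0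
  dom_add : ∀ a b, dom (a + b) = dom a + dom b
  le_mul_cod : ∀ a, a ≼ mul a (cod a)
  cod_cod_mul : ∀ a b, cod (mul (cod a) b) = cod (mul a b)
  cod_le_one : ∀ a, cod a ≼ one
  cod_zero : cod 0 = 0
  cod_add : ∀ a b, cod (a + b) = cod a + cod b
  cod_dom : ∀ a, cod (dom a) = dom a
  dom_cod : ∀ a, dom (cod a) = cod a

/-- A dioid with a star satisfying the unfold and induction axioms. -/
structure IsKleeneAlgebra {S : Type v} [AddCommMonoid S] (mul : S → S → S) (one : S)
    (star : S → S) : Prop extends IsDioid mul one where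
  star_unfold : ∀ a, one + mul a (star a) ≼ star a
  star_induct_left : ∀ a b c, c + mul a b ≼ b → mul (star a) c ≼ b
  star_induct_right : ∀ a b c, c + mul b a ≼ b → mul c (star a) ≼ b

/-! ## Higher semirings and Kleene algebras -/

/-- The operations of an `n`-Kleene algebra besides the common addition and zero. -/
structure NKleeneOps (n : ℕ) (S : Type v) where
  mul : Fin n → S → S → S
  one : Fin n → S
  dom : Fin n → S → S
  cod : Fin n → S → S
  star : Fin n → S → S

/-- The axioms of `n`-semirings (which do not involve the stars). -/
structure IsNSemiring {n : ℕ} {S : Type v} [AddCommMonoid S] (A : NKleeneOps n S) : Prop where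
  modal : ∀ i, IsModalSemiring (A.mul i) (A.one i) (A.dom i) (A.cod i)
  dom_mul_le : ∀ i j, i ≠ j → ∀ a b, A.dom i (A.mul j a b) ≼ A.mul j (A.dom i a) (A.dom i b)
  cod_mul_le : ∀ i j, i ≠ j → ∀ a b, A.cod i (A.mul j a b) ≼ A.mul j (A.cod i a) (A.cod i b)
  interchange : ∀ i j, i < j → ∀ a b c d,
    A.mul i (A.mul j a b) (A.mul j c d) ≼ A.mul j (A.mul i a c) (A.mul i b d)
  dom_dom : ∀ i j, i < j → ∀ a, A.dom j (A.dom i a) = A.dom i a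
  dom_closure : ∀ i j, i < j → ∀ a b,
    A.dom j (A.mul i (A.dom j a) (A.dom j b)) = A.mul i (A.dom j a) (A.dom j b)
  cod_closure : ∀ i j, i < j → ∀ a b,
    A.cod j (A.mul i (A.cod j a) (A.cod j b)) = A.mul i (A.cod j a) (A.cod j b)

/-- The axioms of `n`-Kleene algebras. -/
structure IsNKleeneAlgebra {n : ℕ} {S : Type v} [AddCommMonoid S] (A : NKleeneOps n S) : Prop
    extends IsNSemiring A where
  kleene : ∀ i, IsKleeneAlgebra (A.mul i) (A.one i) (A.star i)
  dom_mul_star : ∀ i j, i < j → ∀ a b,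
    A.mul i (A.dom i a) (A.star j b) ≼ A.star j (A.mul i (A.dom i a) b)
  star_mul_cod : ∀ i j, i < j → ∀ a b,
    A.mul i (A.star j a) (A.cod i b) ≼ A.star j (A.mul i a (A.cod i b))

/-- The convolution operations on functions from a Möbius `n`-catoid of finite valency;
addition and zero of `C → S` are pointwise. -/
noncomputable def NCatoid.convolution {n : ℕ} {C : Type u} {S : Type v} [AddCommMonoid S]
    (X : NCatoid n C) (hM : X.IsMobius) (hV : X.FiniteValency) (A : NKleeneOps n S) :
    NKleeneOps n (C → S) where
  mul i := (X.dim i).convMul (hM i) (A.mul i)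
  one i := (X.dim i).convOne (A.one i)
  dom i := (X.dim i).convDom (hV i) (A.dom i)
  cod i := (X.dim i).convCod (hV i) (A.cod i)
  star i := (X.dim i).convStar (hM i) (A.mul i) (A.star i)

/-! ## The order of a dioid -/

section Order

variable {S : Type v} [AddCommMonoid S]

/-! Addition is idempotent, so every finite sum is a join, and a sum-preserving map sends it below a
bound as soon as it sends every summand there (`PreservesSums.sum_le`). Each inequality between
convolutions therefore reduces to single summands: a summand on the left is indexed by a
factorisation in the catoid, the corresponding catoid axiom turns it into a factorisation occurring
on the right, and the corresponding axiom of the coefficient algebra compares the values. Equalities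
are two such inequalities. Locality enters only in the two axioms `dom_mul_dom` and `cod_cod_mul`.

The star is treated by induction on length. A proper factorisation strictly shortens the right
factor, and identities of a Möbius catoid do not factor properly, so the recursion reduces the
unfold and induction axioms to those of the coefficients (`convOne_add_mul_convStar_le`,
`convStar_mul_le`, `mul_convStar_le`).

For the laws linking dimensions `i < j`, fix one domain value in dimension `i`. Multiplication by it
in dimension `i` is lax multiplicative for `j`, by interchange, and lax for the star of `j`, by
hypothesis. Elements with a given `i`-source are closed under `j`-factors, so `apply_convStar_le`
lifts this laxness from coefficients to the convolution star on that fibre. The codomain law is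
dual. -/

theorem DioidLE.trans {a b c : S} (h₁ : a ≼ b) (h₂ : b ≼ c) : a ≼ c := by
  unfold DioidLE at *
  rw [← h₂, ← add_assoc, h₁]

theorem DioidLE.antisymm {a b : S} (h₁ : a ≼ b) (h₂ : b ≼ a) : a = b := by
  unfold DioidLE at *
  rw [← h₂, add_comm, h₁]

theorem DioidLE.of_zero (a : S) : (0 : S) ≼ a := zero_add a

theorem DioidLE.add_le {a b c : S} (h₁ : a ≼ c) (h₂ : b ≼ c) : a + b ≼ c := by
  unfold DioidLE at *
  rw [add_assoc, h₂, h₁]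

theorem dioidLE_pi_iff {C : Type u} {f g : C → S} : f ≼ g ↔ ∀ x, f x ≼ g x := funext_iff

/-- A map that preserves zero and addition. -/
structure PreservesSums (φ : S → S) : Prop where
  zero : φ 0 = 0
  add : ∀ a b, φ (a + b) = φ a + φ b

theorem PreservesSums.id : PreservesSums (fun a : S => a) := ⟨rfl, fun _ _ => rfl⟩

theorem PreservesSums.comp {φ ψ : S → S} (hφ : PreservesSums φ) (hψ : PreservesSums ψ) :
    PreservesSums (fun a => φ (ψ a)) :=
  ⟨by rw [hψ.zero, hφ.zero], fun a b => by rw [hψ.add, hφ.add]⟩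

theorem PreservesSums.mono {φ : S → S} (hφ : PreservesSums φ) {a b : S} (h : a ≼ b) :
    φ a ≼ φ b := by
  unfold DioidLE at *
  rw [← hφ.add, h]

/-- The map `φ` stands for the context surrounding a sum, such as multiplication by a fixed element
followed by a domain map. Nested sums can thus be opened one at a time without expanding products of
sums. -/
theorem PreservesSums.sum_le {φ : S → S} (hφ : PreservesSums φ) {ι : Type*} {s : Finset ι}
    {f : ι → S} {b : S} (h : ∀ i ∈ s, φ (f i) ≼ b) : φ (∑ i ∈ s, f i) ≼ b := by
  classical
  induction s using Finset.induction_on with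
  | empty => rw [Finset.sum_empty, hφ.zero]; exact DioidLE.of_zero b
  | insert i s hi ih =>
    rw [Finset.sum_insert hi, hφ.add]
    exact (h i (Finset.mem_insert_self i s)).add_le
      (ih fun k hk => h k (Finset.mem_insert_of_mem hk))

end Order

namespace IsDioid

variable {S : Type v} [AddCommMonoid S] {mul : S → S → S} {one : S} (h : IsDioid mul one)
include h

theorem le_refl (a : S) : a ≼ a := h.add_idem a

theorem le_add_left (a b : S) : a ≼ a + b := by
  unfold DioidLE
  rw [← add_assoc, h.add_idem]

theorem le_add_right (a b : S) : b ≼ a + b := by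
  rw [add_comm]
  exact h.le_add_left b a

theorem le_sum {ι : Type*} {s : Finset ι} {f : ι → S} {i : ι} (hi : i ∈ s) :
    f i ≼ ∑ k ∈ s, f k := by
  classical
  rw [← Finset.add_sum_erase s f hi]
  exact h.le_add_left _ _

theorem preservesSums_mul_left (a : S) : PreservesSums (fun b => mul a b) :=
  ⟨h.mul_zero a, h.left_distrib a⟩

theorem preservesSums_mul_right (b : S) : PreservesSums (fun a => mul a b) :=
  ⟨h.zero_mul b, fun a a' => h.right_distrib a a' b⟩

theorem mul_mono {a a' b b' : S} (ha : a ≼ a') (hb : b ≼ b') : mul a b ≼ mul a' b' :=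
  ((h.preservesSums_mul_right b).mono ha).trans ((h.preservesSums_mul_left a').mono hb)

theorem mul_mono_left {a a' : S} (ha : a ≼ a') (b : S) : mul a b ≼ mul a' b :=
  (h.preservesSums_mul_right b).mono ha

theorem mul_mono_right (a : S) {b b' : S} (hb : b ≼ b') : mul a b ≼ mul a b' :=
  (h.preservesSums_mul_left a).mono hb

end IsDioid

namespace IsModalSemiring

variable {S : Type v} [AddCommMonoid S] {mul : S → S → S} {one : S} {dom cod : S → S}
  (h : IsModalSemiring mul one dom cod)
include h

theorem preservesSums_dom : PreservesSums dom := ⟨h.dom_zero, h.dom_add⟩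

theorem preservesSums_cod : PreservesSums cod := ⟨h.cod_zero, h.cod_add⟩

end IsModalSemiring

/-! ### Absorption and monotonicity of the star -/

namespace IsKleeneAlgebra

variable {S : Type v} [AddCommMonoid S] {mul : S → S → S} {one : S} {star : S → S}
  (h : IsKleeneAlgebra mul one star)
include h

theorem one_le_star (a : S) : one ≼ star a :=
  (h.le_add_left _ _).trans (h.star_unfold a)

theorem mul_star_le_star (a : S) : mul a (star a) ≼ star a :=
  (h.le_add_right _ _).trans (h.star_unfold a)

theorem star_mul_le {a b : S} (hab : mul a b ≼ b) : mul (star a) b ≼ b :=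
  h.star_induct_left a b b ((h.le_refl b).add_le hab)

theorem mul_star_le {a b : S} (hab : mul b a ≼ b) : mul b (star a) ≼ b :=
  h.star_induct_right a b b ((h.le_refl b).add_le hab)

theorem le_star_mul (a b : S) : b ≼ mul (star a) b := by
  have := h.mul_mono_left (h.one_le_star a) b
  rwa [h.one_mul] at this

theorem star_mono {a b : S} (hab : a ≼ b) : star a ≼ star b := by
  have h1 : mul (star a) one ≼ star b := h.star_induct_left a (star b) one
    ((h.one_le_star b).add_le
      ((h.mul_mono_left hab _).trans (h.mul_star_le_star b)))
  rwa [h.mul_one] at h1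

end IsKleeneAlgebra

/-! ## Elementary facts on catoids -/

namespace Catoid

section Basic

variable {C : Type u} (c : Catoid C)

theorem tgt_eq_of_isIdentity {e : C} (he : c.IsIdentity e) : c.tgt e = e := by
  rw [← show c.src e = e from he, c.tgt_src]

theorem isIdentity_src (x : C) : c.IsIdentity (c.src x) := c.src_src x

theorem isIdentity_tgt (x : C) : c.IsIdentity (c.tgt x) := c.src_tgt x

theorem mem_src_comp (x : C) : x ∈ c.comp (c.src x) x := by
  rw [c.src_comp]; exact Set.mem_singleton x

theorem mem_comp_tgt (x : C) : x ∈ c.comp x (c.tgt x) := by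
  rw [c.comp_tgt]; exact Set.mem_singleton x

theorem assoc_left {w x y z u : C} (hu : u ∈ c.comp x y) (hw : w ∈ c.comp u z) :
    ∃ v ∈ c.comp y z, w ∈ c.comp x v := by
  have h : w ∈ ⋃ v ∈ c.comp y z, c.comp x v := by
    rw [c.assoc]
    exact Set.mem_biUnion hu hw
  simpa using h

theorem assoc_right {w x y z v : C} (hv : v ∈ c.comp y z) (hw : w ∈ c.comp x v) :
    ∃ u ∈ c.comp x y, w ∈ c.comp u z := by
  have h : w ∈ ⋃ u ∈ c.comp x y, c.comp u z := by
    rw [← c.assoc]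
    exact Set.mem_biUnion hv hw
  simpa using h

theorem tgt_eq_src_of_mem {x y z : C} (h : x ∈ c.comp y z) : c.tgt y = c.src z :=
  c.tgt_eq_src y z ⟨x, h⟩

theorem eq_of_mem_comp_left {x e z : C} (he : c.IsIdentity e) (h : x ∈ c.comp e z) :
    x = z ∧ e = c.src z := by
  have h1 : e = c.src z := by
    rw [← c.tgt_eq_src_of_mem h, c.tgt_eq_of_isIdentity he]
  rw [h1, c.src_comp] at h
  exact ⟨h, h1⟩

theorem eq_of_mem_comp_right {x y e : C} (he : c.IsIdentity e) (h : x ∈ c.comp y e) :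
    x = y ∧ e = c.tgt y := by
  have h1 : e = c.tgt y := by
    rw [c.tgt_eq_src_of_mem h, show c.src e = e from he]
  rw [h1, c.comp_tgt] at h
  exact ⟨h, h1⟩

/-- Split `y` as `c.src y` followed by `y` and reassociate: `x` then has the identity `c.src y` as a
left factor, which must be the source of `x`. -/
theorem src_eq_of_mem {x y z : C} (h : x ∈ c.comp y z) : c.src x = c.src y := by
  obtain ⟨v, hv, hx⟩ := c.assoc_left (c.mem_src_comp y) h
  obtain ⟨rfl, h2⟩ := c.eq_of_mem_comp_left (c.isIdentity_src y) hx
  exact h2.symm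

theorem tgt_eq_of_mem {x y z : C} (h : x ∈ c.comp y z) : c.tgt x = c.tgt z := by
  obtain ⟨v, hv, hx⟩ := c.assoc_right (c.mem_comp_tgt z) h
  obtain ⟨rfl, h2⟩ := c.eq_of_mem_comp_right (c.isIdentity_tgt z) hx
  exact h2.symm

/-- Identities of a Möbius catoid have only trivial factorisations. -/
theorem eq_of_mem_comp_of_isIdentity (h : c.IsMobius) {e y z : C} (he : c.IsIdentity e)
    (hx : e ∈ c.comp y z) : y = e := by
  by_contra hy
  -- The target of `z` is `e`, so `e` is a right factor of `z`, while `z` is a right factor of `e`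
  -- by assumption. Were both left factors nontrivial, the lengths of `e` and `z` would each be
  -- strictly below the other.
  have hze : z ∈ c.comp z e := by
    have h1 := c.mem_comp_tgt z
    rwa [← c.tgt_eq_of_mem hx, c.tgt_eq_of_isIdentity he] at h1
  have hz : z ≠ c.src z := by
    intro hi
    exact hy (c.eq_of_mem_comp_right hi.symm hx).1.symm
  exact lt_asymm (c.length_lt h hx (by rwa [show c.src e = e from he])) (c.length_lt h hze hz)

theorem induction_on_length {p : C → Prop}
    (ih : ∀ x, (∀ y, c.length y < c.length x → p y) → p x) (x : C) : p x :=
  (InvImage.wf c.length wellFounded_lt).induction x ih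

end Basic

/-! ## Convolution in a dioid -/

section Convolution

variable {C : Type u} {K : Type v} [AddCommMonoid K] (c : Catoid C)
  {mul : K → K → K} {one : K} {dom cod star : K → K}

theorem apply_convMul_le (hM : c.IsMobius) {φ : K → K} (hφ : PreservesSums φ) {f g : C → K}
    {x : C} {b : K} (h : ∀ y z, x ∈ c.comp y z → φ (mul (f y) (g z)) ≼ b) :
    φ (c.convMul hM mul f g x) ≼ b :=
  hφ.sum_le fun p hp => h p.1 p.2 ((c.mem_splits hM x p).1 hp)

theorem convMul_le (hM : c.IsMobius) {f g : C → K} {x : C} {b : K}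
    (h : ∀ y z, x ∈ c.comp y z → mul (f y) (g z) ≼ b) : c.convMul hM mul f g x ≼ b :=
  c.apply_convMul_le hM PreservesSums.id h

theorem apply_convDom_le (hV : c.FiniteValency) {φ : K → K} (hφ : PreservesSums φ) {f : C → K}
    {x : C} {b : K} (h : ∀ y, c.src y = x → φ (dom (f y)) ≼ b) :
    φ (c.convDom hV dom f x) ≼ b :=
  hφ.sum_le fun y hy => h y (by simpa using hy)

theorem convDom_le (hV : c.FiniteValency) {f : C → K} {x : C} {b : K}
    (h : ∀ y, c.src y = x → dom (f y) ≼ b) : c.convDom hV dom f x ≼ b :=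
  c.apply_convDom_le hV PreservesSums.id h

theorem apply_convCod_le (hV : c.FiniteValency) {φ : K → K} (hφ : PreservesSums φ) {f : C → K}
    {x : C} {b : K} (h : ∀ y, c.tgt y = x → φ (cod (f y)) ≼ b) :
    φ (c.convCod hV cod f x) ≼ b :=
  hφ.sum_le fun y hy => h y (by simpa using hy)

theorem convCod_le (hV : c.FiniteValency) {f : C → K} {x : C} {b : K}
    (h : ∀ y, c.tgt y = x → cod (f y) ≼ b) : c.convCod hV cod f x ≼ b :=
  c.apply_convCod_le hV PreservesSums.id h

theorem mul_le_convMul (hM : c.IsMobius) (hK : IsDioid mul one) (f g : C → K) {x y z : C}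
    (h : x ∈ c.comp y z) : mul (f y) (g z) ≼ c.convMul hM mul f g x :=
  hK.le_sum (f := fun p : C × C => mul (f p.1) (g p.2)) (i := (y, z))
    ((c.mem_splits hM x (y, z)).2 h)

theorem dom_le_convDom (hV : c.FiniteValency) (hK : IsDioid mul one) (f : C → K) (y : C) :
    dom (f y) ≼ c.convDom hV dom f (c.src y) :=
  hK.le_sum (f := fun y => dom (f y)) (by simp)

theorem cod_le_convCod (hV : c.FiniteValency) (hK : IsDioid mul one) (f : C → K) (y : C) :
    cod (f y) ≼ c.convCod hV cod f (c.tgt y) :=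
  hK.le_sum (f := fun y => cod (f y)) (by simp)

theorem convOne_of_isIdentity {x : C} (hx : c.IsIdentity x) : c.convOne one x = one := by
  simp [convOne, hx]

theorem convOne_of_not_isIdentity {x : C} (hx : ¬ c.IsIdentity x) : c.convOne one x = 0 := by
  simp [convOne, hx]

theorem isDioid_convMul (hM : c.IsMobius) (hK : IsDioid mul one) :
    IsDioid (c.convMul hM mul) (c.convOne one) where
  add_idem f := funext fun x => hK.add_idem (f x)
  mul_assoc f g k := by
    funext x
    refine DioidLE.antisymm ?_ ?_
    · refine c.convMul_le hM fun u z hx => ?_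
      refine c.apply_convMul_le hM (hK.preservesSums_mul_right (k z)) fun y w hu => ?_
      obtain ⟨v, hv, hxv⟩ := c.assoc_left hu hx
      rw [hK.mul_assoc]
      exact (hK.mul_mono_right _ (c.mul_le_convMul hM hK g k hv)).trans
        (c.mul_le_convMul hM hK f _ hxv)
    · refine c.convMul_le hM fun y v hx => ?_
      refine c.apply_convMul_le hM (hK.preservesSums_mul_left (f y)) fun w z hv => ?_
      obtain ⟨u, hu, hxu⟩ := c.assoc_right hv hx
      rw [← hK.mul_assoc]
      exact (hK.mul_mono_left (c.mul_le_convMul hM hK f g hu) _).trans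
        (c.mul_le_convMul hM hK _ k hxu)
  one_mul f := by
    funext x
    refine DioidLE.antisymm (c.convMul_le hM fun y z hx => ?_) ?_
    · by_cases hy : c.IsIdentity y
      · rw [c.convOne_of_isIdentity hy, hK.one_mul, (c.eq_of_mem_comp_left hy hx).1]
        exact hK.le_refl _
      · rw [c.convOne_of_not_isIdentity hy, hK.zero_mul]
        exact DioidLE.of_zero _
    · have := c.mul_le_convMul hM hK (c.convOne one) f (c.mem_src_comp x)
      rwa [c.convOne_of_isIdentity (c.isIdentity_src x), hK.one_mul] at this
  mul_one f := by
    funext x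
    refine DioidLE.antisymm (c.convMul_le hM fun y z hx => ?_) ?_
    · by_cases hz : c.IsIdentity z
      · rw [c.convOne_of_isIdentity hz, hK.mul_one, (c.eq_of_mem_comp_right hz hx).1]
        exact hK.le_refl _
      · rw [c.convOne_of_not_isIdentity hz, hK.mul_zero]
        exact DioidLE.of_zero _
    · have := c.mul_le_convMul hM hK f (c.convOne one) (c.mem_comp_tgt x)
      rwa [c.convOne_of_isIdentity (c.isIdentity_tgt x), hK.mul_one] at this
  left_distrib f g k := by
    funext x
    simp only [convMul, Pi.add_apply, hK.left_distrib, Finset.sum_add_distrib]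
  right_distrib f g k := by
    funext x
    simp only [convMul, Pi.add_apply, hK.right_distrib, Finset.sum_add_distrib]
  zero_mul f := by
    funext x
    simp only [convMul, Pi.zero_apply, hK.zero_mul, Finset.sum_const_zero]
  mul_zero f := by
    funext x
    simp only [convMul, Pi.zero_apply, hK.mul_zero, Finset.sum_const_zero]

/-! ### Domain and codomain of convolutions -/

theorem isModalSemiring_conv (hM : c.IsMobius) (hV : c.FiniteValency) (hL : c.IsLocal)
    (hK : IsModalSemiring mul one dom cod) :
    IsModalSemiring (c.convMul hM mul) (c.convOne one) (c.convDom hV dom)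
      (c.convCod hV cod) where
  toIsDioid := c.isDioid_convMul hM hK.toIsDioid
  le_dom_mul f := dioidLE_pi_iff.2 fun x =>
    (hK.le_dom_mul (f x)).trans <|
      (hK.mul_mono_left (c.dom_le_convDom hV hK.toIsDioid f x) (f x)).trans
        (c.mul_le_convMul hM hK.toIsDioid _ f (c.mem_src_comp x))
  dom_mul_dom f g := by
    have hK' := hK.toIsDioid
    funext e
    refine DioidLE.antisymm ?_ ?_
    · refine c.convDom_le hV ?_
      rintro x rfl
      refine c.apply_convMul_le hM hK.preservesSums_dom fun y z hx => ?_
      refine c.apply_convDom_le hV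
        (hK.preservesSums_dom.comp (hK'.preservesSums_mul_left (f y))) ?_
      rintro w rfl
      rw [hK.dom_mul_dom]
      obtain ⟨rfl, hw⟩ := c.eq_of_mem_comp_right (c.isIdentity_src w) hx
      -- Here locality is indispensable: the summand only records that `x` ends where `w` starts,
      -- and an actual composite `v` is needed to index a summand on the other side.
      obtain ⟨v, hv⟩ := hL x w hw.symm
      rw [← c.src_eq_of_mem hv]
      exact (hK.preservesSums_dom.mono (c.mul_le_convMul hM hK' f g hv)).trans
        (c.dom_le_convDom hV hK' _ v)
    · refine c.convDom_le hV ?_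
      rintro x rfl
      refine c.apply_convMul_le hM hK.preservesSums_dom fun y w hx => ?_
      -- In this direction the composite `x` is given, and the domain of `g` is read off at the
      -- identity where `y` ends; locality plays no role.
      have hy : y ∈ c.comp y (c.src w) := by
        rw [← c.tgt_eq_src_of_mem hx]
        exact c.mem_comp_tgt y
      rw [← hK.dom_mul_dom, c.src_eq_of_mem hx]
      exact (hK.preservesSums_dom.mono <|
        (hK'.mul_mono_right _ (c.dom_le_convDom hV hK' g w)).trans
          (c.mul_le_convMul hM hK' f _ hy)).trans (c.dom_le_convDom hV hK' _ y)
  dom_le_one f := dioidLE_pi_iff.2 fun x => by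
    refine c.convDom_le hV ?_
    rintro y rfl
    rw [c.convOne_of_isIdentity (c.isIdentity_src y)]
    exact hK.dom_le_one _
  dom_zero := by
    funext x
    simp only [convDom, Pi.zero_apply, hK.dom_zero, Finset.sum_const_zero]
  dom_add f g := by
    funext x
    simp only [convDom, Pi.add_apply, hK.dom_add, Finset.sum_add_distrib]
  le_mul_cod f := dioidLE_pi_iff.2 fun x =>
    (hK.le_mul_cod (f x)).trans <|
      (hK.mul_mono_right (f x) (c.cod_le_convCod hV hK.toIsDioid f x)).trans
        (c.mul_le_convMul hM hK.toIsDioid f _ (c.mem_comp_tgt x))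
  cod_cod_mul f g := by
    have hK' := hK.toIsDioid
    funext e
    refine DioidLE.antisymm ?_ ?_
    · refine c.convCod_le hV ?_
      rintro x rfl
      refine c.apply_convMul_le hM hK.preservesSums_cod fun y z hx => ?_
      refine c.apply_convCod_le hV
        (hK.preservesSums_cod.comp (hK'.preservesSums_mul_right (g z))) ?_
      rintro w rfl
      rw [hK.cod_cod_mul]
      obtain ⟨rfl, hw⟩ := c.eq_of_mem_comp_left (c.isIdentity_tgt w) hx
      obtain ⟨v, hv⟩ := hL w x hw
      rw [← c.tgt_eq_of_mem hv]
      exact (hK.preservesSums_cod.mono (c.mul_le_convMul hM hK' f g hv)).trans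
        (c.cod_le_convCod hV hK' _ v)
    · refine c.convCod_le hV ?_
      rintro x rfl
      refine c.apply_convMul_le hM hK.preservesSums_cod fun w z hx => ?_
      have hz : z ∈ c.comp (c.tgt w) z := by
        rw [c.tgt_eq_src_of_mem hx]
        exact c.mem_src_comp z
      rw [← hK.cod_cod_mul, c.tgt_eq_of_mem hx]
      exact (hK.preservesSums_cod.mono <|
        (hK'.mul_mono_left (c.cod_le_convCod hV hK' f w) _).trans
          (c.mul_le_convMul hM hK' _ g hz)).trans (c.cod_le_convCod hV hK' _ z)
  cod_le_one f := dioidLE_pi_iff.2 fun x => by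
    refine c.convCod_le hV ?_
    rintro y rfl
    rw [c.convOne_of_isIdentity (c.isIdentity_tgt y)]
    exact hK.cod_le_one _
  cod_zero := by
    funext x
    simp only [convCod, Pi.zero_apply, hK.cod_zero, Finset.sum_const_zero]
  cod_add f g := by
    funext x
    simp only [convCod, Pi.add_apply, hK.cod_add, Finset.sum_add_distrib]
  cod_dom f := by
    have hK' := hK.toIsDioid
    funext e
    refine DioidLE.antisymm ?_ ?_
    · refine c.convCod_le hV ?_
      rintro y rfl
      refine c.apply_convDom_le hV hK.preservesSums_cod ?_
      rintro w rfl
      rw [hK.cod_dom, c.tgt_src]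
      exact c.dom_le_convDom hV hK' f w
    · refine c.convDom_le hV ?_
      rintro w rfl
      rw [← c.tgt_src w, ← hK.cod_dom]
      exact (hK.preservesSums_cod.mono (c.dom_le_convDom hV hK' f w)).trans
        (c.cod_le_convCod hV hK' _ (c.src w))
  dom_cod f := by
    have hK' := hK.toIsDioid
    funext e
    refine DioidLE.antisymm ?_ ?_
    · refine c.convDom_le hV ?_
      rintro y rfl
      refine c.apply_convCod_le hV hK.preservesSums_dom ?_
      rintro w rfl
      rw [hK.dom_cod, c.src_tgt]
      exact c.cod_le_convCod hV hK' f w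
    · refine c.convCod_le hV ?_
      rintro w rfl
      rw [← c.src_tgt w, ← hK.dom_cod]
      exact (hK.preservesSums_dom.mono (c.cod_le_convCod hV hK' f w)).trans
        (c.dom_le_convDom hV hK' _ (c.tgt w))

/-! ### The convolution star -/

theorem convStar_of_isIdentity (hM : c.IsMobius) (f : C → K) {x : C} (hx : c.IsIdentity x) :
    c.convStar hM mul star f x = star (f x) := by
  rw [convStar, if_pos hx]

open Classical in
/-- The summation in the recursive clause of `convStar`. -/
noncomputable def starTail (hM : c.IsMobius) (mul : K → K → K) (star : K → K) (f : C → K)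
    (x : C) : K :=
  ∑ p ∈ (c.splits hM x).filter fun p => p.1 ≠ c.src x,
    mul (f p.1) (c.convStar hM mul star f p.2)

theorem convStar_of_not_isIdentity (hM : c.IsMobius) (f : C → K) {x : C}
    (hx : ¬ c.IsIdentity x) :
    c.convStar hM mul star f x =
      mul (star (f (c.src x))) (c.starTail hM mul star f x) := by
  classical
  rw [convStar, if_neg hx, starTail]
  congr 1
  exact Finset.sum_attach _ fun p : C × C => mul (f p.1) (c.convStar hM mul star f p.2)

/-- The side condition `y ≠ c.src x` is traded for a strict drop in length, the form in which the
inductions below use it. -/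
theorem apply_starTail_le (hM : c.IsMobius) {φ : K → K} (hφ : PreservesSums φ) {f : C → K}
    {x : C} {b : K}
    (h : ∀ y z, x ∈ c.comp y z → c.length z < c.length x →
      φ (mul (f y) (c.convStar hM mul star f z)) ≼ b) :
    φ (c.starTail hM mul star f x) ≼ b := by
  classical
  refine hφ.sum_le fun p hp => ?_
  have hp' := Finset.mem_filter.1 hp
  have hx := (c.mem_splits hM x p).1 hp'.1
  exact h p.1 p.2 hx (c.length_lt hM hx hp'.2)

theorem mul_le_starTail (hM : c.IsMobius) (hK : IsDioid mul one) (f : C → K) {x y z : C}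
    (hx : x ∈ c.comp y z) (hy : y ≠ c.src x) :
    mul (f y) (c.convStar hM mul star f z) ≼ c.starTail hM mul star f x := by
  classical
  exact hK.le_sum (f := fun p : C × C => mul (f p.1) (c.convStar hM mul star f p.2))
    (i := (y, z)) (Finset.mem_filter.2 ⟨(c.mem_splits hM x (y, z)).2 hx, hy⟩)

/-- A factorisation of `x` is of one of three kinds. If `x` is an identity, the factorisation is
trivial and unfolding in `K` applies. If the left factor is the source of a non-identity `x`, its
value is absorbed by the leading star in the recursive clause. Otherwise the term is already a
summand of the tail, and the leading star is above `one`. -/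
theorem convOne_add_mul_convStar_le (hM : c.IsMobius) (hK : IsKleeneAlgebra mul one star)
    (f : C → K) :
    c.convOne one + c.convMul hM mul f (c.convStar hM mul star f) ≼
      c.convStar hM mul star f := by
  refine dioidLE_pi_iff.2 fun x => DioidLE.add_le ?_ (c.convMul_le hM fun y z hx => ?_)
  · by_cases hx : c.IsIdentity x
    · rw [c.convOne_of_isIdentity hx, c.convStar_of_isIdentity hM f hx]
      exact hK.one_le_star _
    · rw [c.convOne_of_not_isIdentity hx]
      exact DioidLE.of_zero _
  · by_cases hi : c.IsIdentity x
    · obtain rfl := c.eq_of_mem_comp_of_isIdentity hM hi hx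
      obtain ⟨rfl, -⟩ := c.eq_of_mem_comp_left hi hx
      rw [c.convStar_of_isIdentity hM f hi]
      exact hK.mul_star_le_star _
    · by_cases hy : y = c.src x
      · subst hy
        obtain ⟨rfl, -⟩ := c.eq_of_mem_comp_left (c.isIdentity_src x) hx
        rw [c.convStar_of_not_isIdentity hM f hi, ← hK.mul_assoc]
        exact hK.mul_mono_left (hK.mul_star_le_star _) _
      · rw [c.convStar_of_not_isIdentity hM f hi]
        exact (c.mul_le_starTail hM hK.toIsDioid f hx hy).trans (hK.le_star_mul _ _)

/-- Induction on the length of the starred left factor `y`. Its leading star sits at the common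
source of `y` and `x`, so it is absorbed by `g x` through star induction in `K`. For a tail summand,
reassociation moves the shorter factor next to `z`, where the induction hypothesis turns the product
into a value of `g`. -/
theorem convStar_mul_le (hM : c.IsMobius) (hK : IsKleeneAlgebra mul one star) {f g k : C → K}
    (hkg : k ≼ g) (hfg : c.convMul hM mul f g ≼ g) :
    c.convMul hM mul (c.convStar hM mul star f) k ≼ g := by
  have hK' := hK.toIsDioid
  rw [dioidLE_pi_iff] at hkg hfg
  have hmul : ∀ {x y z : C}, x ∈ c.comp y z → mul (f y) (g z) ≼ g x := fun {x _ _} h =>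
    (c.mul_le_convMul hM hK' f g h).trans (hfg x)
  refine dioidLE_pi_iff.2 fun x => c.convMul_le hM fun y => ?_
  induction y using c.induction_on_length generalizing x with
  | ih y ih =>
    intro z hx
    have hs : mul (star (f (c.src y))) (g x) ≼ g x := by
      rw [← c.src_eq_of_mem hx]
      exact hK.star_mul_le (hmul (c.mem_src_comp x))
    by_cases hy : c.IsIdentity y
    · obtain ⟨rfl, -⟩ := c.eq_of_mem_comp_left hy hx
      rw [c.convStar_of_isIdentity hM f hy]
      rw [show c.src y = y from hy] at hs
      exact (hK'.mul_mono_right _ (hkg x)).trans hs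
    · rw [c.convStar_of_not_isIdentity hM f hy, hK.mul_assoc]
      refine (hK'.mul_mono_right _ ?_).trans hs
      refine c.apply_starTail_le hM (hK'.preservesSums_mul_right (k z)) fun u v hyuv hlt => ?_
      obtain ⟨w, hw, hxw⟩ := c.assoc_left hyuv hx
      rw [hK.mul_assoc]
      exact (hK'.mul_mono_right _ (ih v hlt w z hw)).trans (hmul hxw)

theorem mul_convStar_le (hM : c.IsMobius) (hK : IsKleeneAlgebra mul one star) {f g k : C → K}
    (hkg : k ≼ g) (hgf : c.convMul hM mul g f ≼ g) :
    c.convMul hM mul k (c.convStar hM mul star f) ≼ g := by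
  have hK' := hK.toIsDioid
  rw [dioidLE_pi_iff] at hkg hgf
  have hmul : ∀ {x y z : C}, x ∈ c.comp y z → mul (g y) (f z) ≼ g x := fun {x _ _} h =>
    (c.mul_le_convMul hM hK' g f h).trans (hgf x)
  -- The star unfolds from the left, so here the unstarred left factor absorbs the pieces peeled
  -- off. After one step that factor is a value of `g` rather than of `k`, so the induction must be
  -- run with `g` from the start.
  have key : ∀ z x y, x ∈ c.comp y z → mul (g y) (c.convStar hM mul star f z) ≼ g x := by
    intro z
    induction z using c.induction_on_length with
    | ih z ih =>
      intro x y hx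
      have hs : mul (g y) (star (f (c.src z))) ≼ g y := by
        rw [← c.tgt_eq_src_of_mem hx]
        exact hK.mul_star_le (hmul (c.mem_comp_tgt y))
      by_cases hz : c.IsIdentity z
      · obtain ⟨rfl, -⟩ := c.eq_of_mem_comp_right hz hx
        rwa [c.convStar_of_isIdentity hM f hz, ← show c.src z = z from hz]
      · rw [c.convStar_of_not_isIdentity hM f hz, ← hK.mul_assoc]
        refine (hK'.mul_mono_left hs _).trans ?_
        refine c.apply_starTail_le hM (hK'.preservesSums_mul_left (g y)) fun u v hzuv hlt => ?_
        obtain ⟨w, hw, hxw⟩ := c.assoc_right hzuv hx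
        rw [← hK.mul_assoc]
        exact (hK'.mul_mono_left (hmul hw) _).trans (ih v hlt x w hxw)
  exact dioidLE_pi_iff.2 fun x => c.convMul_le hM fun y z hx =>
    (hK'.mul_mono_left (hkg y) _).trans (key z x y hx)

/-- If `φ` is lax multiplicative for `mul`, lax compatible with the star, and dominated
pointwise by `g` on a set of elements closed under factors, then it is lax compatible with the
convolution star on this set. -/
theorem apply_convStar_le (hM : c.IsMobius) (hK : IsKleeneAlgebra mul one star) {φ : K → K}
    (hφ : PreservesSums φ) (hmul : ∀ a b, φ (mul a b) ≼ mul (φ a) (φ b))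
    (hstar : ∀ a, φ (star a) ≼ star (φ a)) {p : C → Prop}
    (hp : ∀ {x y z}, x ∈ c.comp y z → p x → p y ∧ p z) {f g : C → K}
    (hfg : ∀ x, p x → φ (f x) ≼ g x) (x : C) (hx : p x) :
    φ (c.convStar hM mul star f x) ≼ c.convStar hM mul star g x := by
  have hK' := hK.toIsDioid
  induction x using c.induction_on_length with
  | ih x ih =>
    have hs : ∀ y, p y → φ (star (f y)) ≼ star (g y) := fun y hy =>
      (hstar _).trans (hK.star_mono (hfg y hy))
    by_cases hi : c.IsIdentity x
    · rw [c.convStar_of_isIdentity hM f hi, c.convStar_of_isIdentity hM g hi]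
      exact hs x hx
    · rw [c.convStar_of_not_isIdentity hM f hi]
      -- The leading star can be multiplied on again at no cost. It therefore suffices to bound the
      -- image of the tail by the whole star of `g` at `x`, instead of by its tail.
      have hgs : mul (star (g (c.src x))) (c.convStar hM mul star g x) ≼
          c.convStar hM mul star g x := by
        rw [c.convStar_of_not_isIdentity hM g hi, ← hK.mul_assoc]
        exact hK'.mul_mono_left (hK.star_mul_le (hK.mul_star_le_star _)) _
      refine (hmul _ _).trans <| DioidLE.trans (hK'.mul_mono
        (hs _ (hp (c.mem_src_comp x) hx).1) ?_) hgs
      refine c.apply_starTail_le hM hφ fun y z hxyz hlt => ?_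
      have hpyz := hp hxyz hx
      -- The resulting product is a summand of `g` convolved with its star, which lies below the
      -- star by the unfold law.
      refine (hmul _ _).trans <|
        (hK'.mul_mono (hfg y hpyz.1) (ih z hlt hpyz.2)).trans <|
          (c.mul_le_convMul hM hK' g _ hxyz).trans ?_
      exact ((hK'.le_add_right _ _).trans
        (dioidLE_pi_iff.1 (c.convOne_add_mul_convStar_le hM hK g) x))

theorem isKleeneAlgebra_conv (hM : c.IsMobius) (hK : IsKleeneAlgebra mul one star) :
    IsKleeneAlgebra (c.convMul hM mul) (c.convOne one) (c.convStar hM mul star) where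
  toIsDioid := c.isDioid_convMul hM hK.toIsDioid
  star_unfold := c.convOne_add_mul_convStar_le hM hK
  star_induct_left f g k h := by
    have hD := c.isDioid_convMul hM hK.toIsDioid
    exact c.convStar_mul_le hM hK ((hD.le_add_left _ _).trans h) ((hD.le_add_right _ _).trans h)
  star_induct_right f g k h := by
    have hD := c.isDioid_convMul hM hK.toIsDioid
    exact c.mul_convStar_le hM hK ((hD.le_add_left _ _).trans h) ((hD.le_add_right _ _).trans h)

end Convolution

end Catoid

/-! ## Convolution in an `n`-Kleene algebra -/

namespace IsNSemiring

variable {n : ℕ} {S : Type v} [AddCommMonoid S] {A : NKleeneOps n S} (hA : IsNSemiring A)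
include hA

/-- A codomain value is its own `dom i`, so the axiom `dom_dom` already covers it. This makes the
interchange argument for domain values available for codomain values too. -/
theorem dom_cod_of_lt {i j : Fin n} (hij : i < j) (a : S) : A.dom j (A.cod i a) = A.cod i a := by
  rw [← (hA.modal i).dom_cod, hA.dom_dom i j hij]

/-- Multiplication by a fixed point of `dom j` is lax multiplicative for `mul j`. -/
theorem mul_mul_le_of_dom_eq {i j : Fin n} (hij : i < j) {a : S} (ha : A.dom j a = a) (b c : S) :
    A.mul i a (A.mul j b c) ≼ A.mul j (A.mul i a b) (A.mul i a c) := by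
  -- Being fixed by `dom j` gives `a ≼ A.mul j a a`; this duplication of `a` supplies the fourth
  -- entry that interchange needs.
  have h := (hA.modal j).le_dom_mul a
  rw [ha] at h
  exact ((hA.modal i).mul_mono_left h _).trans (hA.interchange i j hij a a b c)

theorem mul_mul_le_of_dom_eq_right {i j : Fin n} (hij : i < j) {a : S} (ha : A.dom j a = a)
    (b c : S) :
    A.mul i (A.mul j b c) a ≼ A.mul j (A.mul i b a) (A.mul i c a) := by
  have h := (hA.modal j).le_dom_mul a
  rw [ha] at h
  exact ((hA.modal i).mul_mono_right _ h).trans (hA.interchange i j hij b c a a)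

end IsNSemiring

namespace NCatoid

variable {n : ℕ} {C : Type u} {K : Type v} [AddCommMonoid K] (X : NCatoid n C)
  {A : NKleeneOps n K}

/-- The `i`-source of `x` lies in the `j`-composite of the `i`-sources of `y` and `z`. As `i < j`,
these are `j`-identities, so the composite is trivial and all three sources agree. The fibres of the
`i`-source are thus closed under `j`-factors. -/
theorem src_eq_of_mem_of_lt {i j : Fin n} (hij : i < j) {x y z : C}
    (hx : x ∈ (X.dim j).comp y z) :
    (X.dim i).src y = (X.dim i).src x ∧ (X.dim i).src z = (X.dim i).src x := by
  have h := X.src_comp_subset i j hij.ne y z ⟨x, hx, rfl⟩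
  obtain ⟨h1, h2⟩ := (X.dim j).eq_of_mem_comp_left (X.src_src_of_lt i j hij y) h
  exact ⟨by rw [h2, X.src_src_of_lt i j hij, h1], h1.symm⟩

theorem tgt_eq_of_mem_of_lt {i j : Fin n} (hij : i < j) {x y z : C}
    (hx : x ∈ (X.dim j).comp y z) :
    (X.dim i).tgt y = (X.dim i).tgt x ∧ (X.dim i).tgt z = (X.dim i).tgt x := by
  have h := X.tgt_comp_subset i j hij.ne y z ⟨x, hx, rfl⟩
  obtain ⟨h1, h2⟩ := (X.dim j).eq_of_mem_comp_left (X.src_tgt_of_lt i j hij y) h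
  exact ⟨by rw [h2, X.src_tgt_of_lt i j hij, h1], h1.symm⟩

theorem isNSemiring_convolution (hL : X.IsLocal) (hM : X.IsMobius) (hV : X.FiniteValency)
    (hA : IsNSemiring A) : IsNSemiring (X.convolution hM hV A) where
  modal i := (X.dim i).isModalSemiring_conv (hM i) (hV i) (hL i) (hA.modal i)
  dom_mul_le i j hij f g := dioidLE_pi_iff.2 fun e => by
    refine (X.dim i).convDom_le (hV i) ?_
    rintro x rfl
    refine (X.dim j).apply_convMul_le (hM j) (hA.modal i).preservesSums_dom fun y z hx => ?_
    refine (hA.dom_mul_le i j hij _ _).trans ?_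
    have hD := (hA.modal j).toIsDioid
    exact (hD.mul_mono ((X.dim i).dom_le_convDom (hV i) hD f y)
      ((X.dim i).dom_le_convDom (hV i) hD g z)).trans
        ((X.dim j).mul_le_convMul (hM j) hD _ _ (X.src_comp_subset i j hij y z ⟨x, hx, rfl⟩))
  cod_mul_le i j hij f g := dioidLE_pi_iff.2 fun e => by
    refine (X.dim i).convCod_le (hV i) ?_
    rintro x rfl
    refine (X.dim j).apply_convMul_le (hM j) (hA.modal i).preservesSums_cod fun y z hx => ?_
    refine (hA.cod_mul_le i j hij _ _).trans ?_
    have hD := (hA.modal j).toIsDioid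
    exact (hD.mul_mono ((X.dim i).cod_le_convCod (hV i) hD f y)
      ((X.dim i).cod_le_convCod (hV i) hD g z)).trans
        ((X.dim j).mul_le_convMul (hM j) hD _ _ (X.tgt_comp_subset i j hij y z ⟨x, hx, rfl⟩))
  interchange i j hij f g k l := dioidLE_pi_iff.2 fun x => by
    have hi := (hA.modal i).toIsDioid
    have hj := (hA.modal j).toIsDioid
    refine (X.dim i).convMul_le (hM i) fun u v hx => ?_
    refine (X.dim j).apply_convMul_le (hM j) (hi.preservesSums_mul_right _) fun a b hu => ?_
    refine (X.dim j).apply_convMul_le (hM j) (hi.preservesSums_mul_left _) fun c d hv => ?_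
    refine (hA.interchange i j hij _ _ _ _).trans ?_
    have h : x ∈ (X.dim i).compSet ((X.dim j).comp a b) ((X.dim j).comp c d) :=
      Set.mem_biUnion hu (Set.mem_biUnion hv hx)
    have h' := X.interchange i j hij a b c d h
    simp only [Catoid.compSet, Set.mem_iUnion] at h'
    obtain ⟨p, hp, q, hq, hx'⟩ := h'
    exact (hj.mul_mono ((X.dim i).mul_le_convMul (hM i) hi f k hp)
      ((X.dim i).mul_le_convMul (hM i) hi g l hq)).trans
        ((X.dim j).mul_le_convMul (hM j) hj _ _ hx')
  dom_dom i j hij f := by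
    have hi := (hA.modal i).toIsDioid
    funext e
    refine DioidLE.antisymm ?_ ?_
    · refine (X.dim j).convDom_le (hV j) ?_
      rintro y rfl
      refine (X.dim i).apply_convDom_le (hV i) (hA.modal j).preservesSums_dom ?_
      rintro w rfl
      rw [hA.dom_dom i j hij, X.src_src_of_lt i j hij]
      exact (X.dim i).dom_le_convDom (hV i) hi f w
    · refine (X.dim i).convDom_le (hV i) ?_
      rintro w rfl
      rw [← hA.dom_dom i j hij, ← X.src_src_of_lt i j hij]
      exact ((hA.modal j).preservesSums_dom.mono
        ((X.dim i).dom_le_convDom (hV i) hi f w)).trans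
          ((X.dim j).dom_le_convDom (hV j) hi _ ((X.dim i).src w))
  dom_closure i j hij f g := by
    have hi := (hA.modal i).toIsDioid
    have hd := (hA.modal j).preservesSums_dom
    funext e
    refine DioidLE.antisymm ?_ ?_
    · refine (X.dim j).convDom_le (hV j) ?_
      rintro x rfl
      refine (X.dim i).apply_convMul_le (hM i) hd fun y z hx => ?_
      refine (X.dim j).apply_convDom_le (hV j) (hd.comp (hi.preservesSums_mul_right _)) ?_
      rintro u rfl
      refine (X.dim j).apply_convDom_le (hV j) (hd.comp (hi.preservesSums_mul_left _)) ?_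
      rintro v rfl
      rw [hA.dom_closure i j hij]
      have hx' := (X.src_closure i j hij u v).subset ⟨x, hx, rfl⟩
      exact (hi.mul_mono ((X.dim j).dom_le_convDom (hV j) hi f u)
        ((X.dim j).dom_le_convDom (hV j) hi g v)).trans
          ((X.dim i).mul_le_convMul (hM i) hi _ _ hx')
    · refine (X.dim i).convMul_le (hM i) fun y z he => ?_
      refine (X.dim j).apply_convDom_le (hV j) (hi.preservesSums_mul_right _) ?_
      rintro u rfl
      refine (X.dim j).apply_convDom_le (hV j) (hi.preservesSums_mul_left _) ?_
      rintro v rfl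
      -- This uses the other inclusion of the closure axiom: every element of a composite of
      -- `j`-sources is itself the `j`-source of some element of that composite.
      obtain ⟨x, hx, rfl⟩ := (X.src_closure i j hij u v).superset he
      rw [← hA.dom_closure i j hij]
      exact (hd.mono <| (hi.mul_mono ((X.dim j).dom_le_convDom (hV j) hi f u)
        ((X.dim j).dom_le_convDom (hV j) hi g v)).trans
          ((X.dim i).mul_le_convMul (hM i) hi _ _ hx)).trans
            ((X.dim j).dom_le_convDom (hV j) hi _ x)
  cod_closure i j hij f g := by
    have hi := (hA.modal i).toIsDioid
    have hd := (hA.modal j).preservesSums_cod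
    funext e
    refine DioidLE.antisymm ?_ ?_
    · refine (X.dim j).convCod_le (hV j) ?_
      rintro x rfl
      refine (X.dim i).apply_convMul_le (hM i) hd fun y z hx => ?_
      refine (X.dim j).apply_convCod_le (hV j) (hd.comp (hi.preservesSums_mul_right _)) ?_
      rintro u rfl
      refine (X.dim j).apply_convCod_le (hV j) (hd.comp (hi.preservesSums_mul_left _)) ?_
      rintro v rfl
      rw [hA.cod_closure i j hij]
      have hx' := (X.tgt_closure i j hij u v).subset ⟨x, hx, rfl⟩
      exact (hi.mul_mono ((X.dim j).cod_le_convCod (hV j) hi f u)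
        ((X.dim j).cod_le_convCod (hV j) hi g v)).trans
          ((X.dim i).mul_le_convMul (hM i) hi _ _ hx')
    · refine (X.dim i).convMul_le (hM i) fun y z he => ?_
      refine (X.dim j).apply_convCod_le (hV j) (hi.preservesSums_mul_right _) ?_
      rintro u rfl
      refine (X.dim j).apply_convCod_le (hV j) (hi.preservesSums_mul_left _) ?_
      rintro v rfl
      obtain ⟨x, hx, rfl⟩ := (X.tgt_closure i j hij u v).superset he
      rw [← hA.cod_closure i j hij]
      exact (hd.mono <| (hi.mul_mono ((X.dim j).cod_le_convCod (hV j) hi f u)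
        ((X.dim j).cod_le_convCod (hV j) hi g v)).trans
          ((X.dim i).mul_le_convMul (hM i) hi _ _ hx)).trans
            ((X.dim j).cod_le_convCod (hV j) hi _ x)

/-- Domains are supported on `i`-identities, so a summand at `x` is one value `A.dom i (f w)` times
the star of `g` at `x` itself, where `w` and `x` share their `i`-source. With `w` fixed,
`apply_convStar_le` applies on the fibre of this source. -/
theorem convDom_mul_convStar_le (hM : X.IsMobius) (hV : X.FiniteValency)
    (hA : IsNKleeneAlgebra A) {i j : Fin n} (hij : i < j) (f g : C → K) :
    (X.convolution hM hV A).mul i ((X.convolution hM hV A).dom i f)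
        ((X.convolution hM hV A).star j g) ≼
      (X.convolution hM hV A).star j
        ((X.convolution hM hV A).mul i ((X.convolution hM hV A).dom i f) g) := by
  have hi := (hA.modal i).toIsDioid
  refine dioidLE_pi_iff.2 fun x => (X.dim i).convMul_le (hM i) fun y z hx => ?_
  refine (X.dim i).apply_convDom_le (hV i) (hi.preservesSums_mul_right _) ?_
  rintro w rfl
  obtain ⟨rfl, hw⟩ := (X.dim i).eq_of_mem_comp_left ((X.dim i).isIdentity_src w) hx
  refine (X.dim j).apply_convStar_le (hM j) (hA.kleene j)
    (φ := fun a => A.mul i (A.dom i (f w)) a) (hi.preservesSums_mul_left _)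
    (hA.mul_mul_le_of_dom_eq hij (hA.dom_dom i j hij _)) (hA.dom_mul_star i j hij _)
    (p := fun x => (X.dim i).src w = (X.dim i).src x) ?_ ?_ x hw
  · intro x y z hx hp
    have h := X.src_eq_of_mem_of_lt hij hx
    exact ⟨hp.trans h.1.symm, hp.trans h.2.symm⟩
  -- On the fibre, the fixed value is one summand of the domain of `f` at the `i`-source of `x`, and
  -- the trivial factorisation of `x` through its source brings in the convolution product.
  · intro x hp
    have h := (X.dim i).dom_le_convDom (dom := A.dom i) (hV i) hi f w
    rw [hp] at h
    exact (hi.mul_mono_left h _).trans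
      ((X.dim i).mul_le_convMul (hM i) hi _ g ((X.dim i).mem_src_comp x))

theorem convStar_mul_convCod_le (hM : X.IsMobius) (hV : X.FiniteValency)
    (hA : IsNKleeneAlgebra A) {i j : Fin n} (hij : i < j) (f g : C → K) :
    (X.convolution hM hV A).mul i ((X.convolution hM hV A).star j f)
        ((X.convolution hM hV A).cod i g) ≼
      (X.convolution hM hV A).star j
        ((X.convolution hM hV A).mul i f ((X.convolution hM hV A).cod i g)) := by
  have hi := (hA.modal i).toIsDioid
  refine dioidLE_pi_iff.2 fun x => (X.dim i).convMul_le (hM i) fun y z hx => ?_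
  refine (X.dim i).apply_convCod_le (hV i) (hi.preservesSums_mul_left _) ?_
  rintro w rfl
  obtain ⟨rfl, hw⟩ := (X.dim i).eq_of_mem_comp_right ((X.dim i).isIdentity_tgt w) hx
  refine (X.dim j).apply_convStar_le (hM j) (hA.kleene j)
    (φ := fun a => A.mul i a (A.cod i (g w))) (hi.preservesSums_mul_right _)
    (hA.mul_mul_le_of_dom_eq_right hij (hA.dom_cod_of_lt hij _))
    (fun a => hA.star_mul_cod i j hij a _)
    (p := fun x => (X.dim i).tgt w = (X.dim i).tgt x) ?_ ?_ x hw
  · intro x y z hx hp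
    have h := X.tgt_eq_of_mem_of_lt hij hx
    exact ⟨hp.trans h.1.symm, hp.trans h.2.symm⟩
  · intro x hp
    have h := (X.dim i).cod_le_convCod (cod := A.cod i) (hV i) hi g w
    rw [hp] at h
    exact (hi.mul_mono_right _ h).trans
      ((X.dim i).mul_le_convMul (hM i) hi f _ ((X.dim i).mem_comp_tgt x))

end NCatoid

theorem mainTheorem4 {n : ℕ} {C : Type*} {K : Type*} [AddCommMonoid K]
    (X : NCatoid n C) (hlocal : X.IsLocal) (hM : X.IsMobius) (hV : X.FiniteValency)
    (A : NKleeneOps n K) (hA : IsNKleeneAlgebra A) :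
    IsNKleeneAlgebra (X.convolution hM hV A) where
  toIsNSemiring := X.isNSemiring_convolution hlocal hM hV hA.toIsNSemiring
  kleene i := (X.dim i).isKleeneAlgebra_conv (hM i) (hA.kleene i)
  dom_mul_star _ _ hij := X.convDom_mul_convStar_le hM hV hA hij
  star_mul_cod _ _ hij := X.convStar_mul_convCod_le hM hV hA hij
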